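/- **Setting.** Let $\mathcal G_0$ be a finite connected undirected multigraph (loops and multiple edges allowed) with vertex set $V_0$, $|V_0|=p$, and edge set $E_0$. A Jacobi matrix $J_0$ on $\mathcal G_0$ is given by weights $a_e>0$ ($e\in E_0$) and a real potential $b_v$ ($v\in V_0$): $(J_0)_{vv}=b_v+2\sum_{e\text{ loop at }v}a_e$, and $(J_0)_{vw}=\sum_{e\text{ between }v\text{ and }w}a_e$ for $v\ne w$. If $\mathcal G\to\mathcal G_0$ is a covering of multigraphs with $\mathcal G$ finite (not necessarily connected), the lift $J$ of $J_0$ is the Jacobi matrix on $\mathcal G$ whose weights and potential are pulled back from $\mathcal G_0$. Choose edges $e_1,\dots,e_\ell$ of $\mathcal G_0$ whose removal turns $\mathcal G_0$ into a tree, choose a direction for each $e_i$, and put $d=2\ell$. Let $B$ be the $p\times p$ matrix of the restriction of $J_0$ to this tree (same potential, edges $e_1,\dots,e_\ell$ removed). Let $A_i$ be the $p\times p$ matrix whose only nonzero entry is $(A_i)_{vw}=a_{e_i}$, where $v$ is the initial and $w$ the terminal vertex of $e_i$. Put $A=\sum_{i=1}^{\ell}(A_i+A_i^*)$. The vertices of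 $\mathcal G$ are arranged in copies of $V_0$ indexed by a finite set $W$, so that every lift of an edge of the tree stays inside one copy, and the lift of $e_i$ whose initial vertex is in the copy $u$ has its terminal vertex in the copy $u+e_i$, where $u\mapsto u+e_i$ is a permutation of $W$ with inverse $u\mapsto u-e_i$. The skeleton $G$ is the $d$-regular multigraph on $W$ with one edge between $u$ and $u+e_i$ for every $u\in W$ and $1\le i\le\ell$; this edge is said to be weighted by $A_i$ (from $u$ to $u+e_i$) or $A_i^*$ (in the other direction). Thus $J$ acts on $L^2(G,\mathbb C^p)$ by $$(Jx)_u=Bx_u+\sum_{i=1}^{\ell}\left(A_ix_{u+e_i}+A_i^*x_{u-e_i}\right).$$ **Theorem.** Let $r\ge1$ be an integer and $j\in\{1,\dots,\ell\}$. Suppose that $G$ has two edges, each weighted by $A_j$ or $A_j^*$, such that in $G$ every end of the first is at distance greater than $2r+2$ from every end of the second (the distance between different components is $\infty$). Then $J$ has at least two eigenvalues counted with multiplicity, and for every unit vector $y\in\mathbb C^p$ with non-negative entries the second largest eigenvalue (counted with multiplicity) of $J$ satisfies $$\lambda_2(J)\ \ge\ \langle By,y\rangle+2\sqrt{d-1}\,\frac{\langle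 Ay,y\rangle}{d}-\frac{C_j}{r},$$ where $$C_j=\left(2\sqrt{d-1}-1\right)\frac{\langle Ay,y\rangle}{d}+\left|\frac{\langle Ay,y\rangle}{d}-\langle A_jy,y\rangle\right|.$$ -/

import Mathlib

open scoped ComplexOrder

/-- An undirected multigraph (multiple edges and loops are allowed) with vertex set `V` and edge
set `E`. Each edge carries an arbitrary reference direction from `src e` to `tgt e`; it is used
only to write down coverings and the matrices `A_i`, and plays no role in adjacency, in distances
or in Jacobi matrices. -/
structure Multigraph (V E : Type*) where
  src : E → V
  tgt : E → V

namespace Multigraph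

/-- The simple graph of all pairs of distinct vertices joined by at least one edge (in either
direction). It has the same distances as the multigraph. -/
def toSimple {V E : Type*} (G : Multigraph V E) : SimpleGraph V :=
  SimpleGraph.fromRel fun v w => ∃ e, G.src e = v ∧ G.tgt e = w

/-- The graph distance, with value `⊤` between different connected components. -/
noncomputable def edist {V E : Type*} (G : Multigraph V E) (v w : V) : ℕ∞ :=
  G.toSimple.edist v w

/-- A multigraph is a tree when it has no loops, no multiple edges, and its underlying simple
graph is a tree. -/
structure IsTree {V E : Type*} (G : Multigraph V E) : Prop where
  no_loop : ∀ e, G.src e ≠ G.tgt e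
  no_multi : Function.Injective fun e => s(G.src e, G.tgt e)
  tree : G.toSimple.IsTree

/-- The multigraph with the same vertices, where only the edges in `S` are kept. -/
def restrict {V E : Type*} (G : Multigraph V E) (S : Set E) : Multigraph V S where
  src e := G.src e
  tgt e := G.tgt e

end Multigraph

/-- The weights of a Jacobi matrix on `G`: positive edge weights `a` and a real potential `b`. -/
structure JacobiData {V E : Type*} (G : Multigraph V E) where
  a : E → ℝ
  a_pos : ∀ e, 0 < a e
  b : V → ℝ

namespace JacobiData

/-- The Jacobi matrix. An edge between different vertices `v`, `w` adds `a e` to the entries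
`(v, w)` and `(w, v)`; a loop at `v` adds `2 * a e` to the entry `(v, v)`. -/
noncomputable def matrix {V E : Type*} [DecidableEq V] [Fintype E] {G : Multigraph V E}
    (J : JacobiData G) : Matrix V V ℂ := fun v w =>
  (if v = w then (J.b v : ℂ) else 0) +
    ∑ e, ((if G.src e = v ∧ G.tgt e = w then (J.a e : ℂ) else 0) +
      (if G.tgt e = v ∧ G.src e = w then (J.a e : ℂ) else 0))

theorem isHermitian {V E : Type*} [DecidableEq V] [Fintype E] {G : Multigraph V E}
    (J : JacobiData G) : J.matrix.IsHermitian := by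
  ext v w
  simp only [Matrix.conjTranspose_apply, matrix, star_add, star_sum]
  congr 1
  · by_cases h : v = w
    · subst h; simp
    · simp [h, Ne.symm h]
  · refine Finset.sum_congr rfl fun e _ => ?_
    rw [add_comm]
    congr 1
    · by_cases h : G.tgt e = w ∧ G.src e = v
      · simp [h]
      · rw [if_neg h, if_neg (fun k => h k.symm), star_zero]
    · by_cases h : G.src e = w ∧ G.tgt e = v
      · simp [h]
      · rw [if_neg h, if_neg (fun k => h k.symm), star_zero]

/-- The Jacobi data that remain when only the edges in `S` are kept. -/
def restrict {V E : Type*} {G : Multigraph V E} (J : JacobiData G) (S : Set E) :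
    JacobiData (G.restrict S) where
  a e := J.a e
  a_pos e := J.a_pos e
  b := J.b

end JacobiData

/-- A covering map of multigraphs `H → G`: maps of vertices and of edges that respect end points
(the reference directions of `H` being those lifted from `G`) and are bijective on the half-edges
at every vertex. The cover need not be connected. -/
structure Covering {V' E' V E : Type*} (H : Multigraph V' E') (G : Multigraph V E) where
  vert : V' → V
  edge : E' → E
  vert_src : ∀ e', vert (H.src e') = G.src (edge e')
  vert_tgt : ∀ e', vert (H.tgt e') = G.tgt (edge e')
  lift_src : ∀ x e, G.src e = vert x → ∃! e', edge e' = e ∧ H.src e' = x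
  lift_tgt : ∀ x e, G.tgt e = vert x → ∃! e', edge e' = e ∧ H.tgt e' = x

/-- The lift of Jacobi data along a covering. -/
def JacobiData.lift {V' E' V E : Type*} {H : Multigraph V' E'} {G : Multigraph V E}
    (J : JacobiData G) (c : Covering H G) : JacobiData H where
  a e' := J.a (c.edge e')
  a_pos e' := J.a_pos (c.edge e')
  b x := J.b (c.vert x)

/-- The edges `e_1, …, e_ℓ` are such that removing them turns `G` into a tree. -/
def IsTreeCut {V E : Type*} {ℓ : ℕ} (G : Multigraph V E) (cut : Fin ℓ ↪ E) : Prop :=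
  (G.restrict (Set.range cut)ᶜ).IsTree

/-- The matrix `B`: the Jacobi matrix of the tree left after removing `e_1, …, e_ℓ`. -/
noncomputable def blockB {V E : Type*} [DecidableEq V] [Fintype E] {G : Multigraph V E}
    (J : JacobiData G) {ℓ : ℕ} (cut : Fin ℓ ↪ E) : Matrix V V ℂ :=
  haveI : Fintype ((Set.range cut)ᶜ : Set E) := Fintype.ofFinite _
  (J.restrict (Set.range cut)ᶜ).matrix

/-- The matrix `A_i`: its only nonzero entry is the weight of `e_i`, in the row of the initial
vertex and the column of the terminal vertex of `e_i`. -/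
noncomputable def blockA {V E : Type*} [DecidableEq V] {G : Multigraph V E}
    (J : JacobiData G) {ℓ : ℕ} (cut : Fin ℓ ↪ E) (i : Fin ℓ) : Matrix V V ℂ := fun v w =>
  if G.src (cut i) = v ∧ G.tgt (cut i) = w then (J.a (cut i) : ℂ) else 0

/-- The matrix `A = ∑ i, (A_i + A_i^*)`. -/
noncomputable def blockSum {V E : Type*} [DecidableEq V] {G : Multigraph V E}
    (J : JacobiData G) {ℓ : ℕ} (cut : Fin ℓ ↪ E) : Matrix V V ℂ :=
  ∑ i, (blockA J cut i + (blockA J cut i).conjTranspose)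

/-- A lego block picture of a covering `c : H → G`, relative to the cut edges `e_1, …, e_ℓ` of
`G`. The vertices of `H` are arranged as copies of the vertex set of `G`, one copy for each `u : W`;
the lifts of the uncut edges stay inside a copy, and the lift of `e_i` that starts in copy `u` ends
in the copy `shift i u`, the neighbor `u + e_i` of `u`. See `exists_legoView` and
`LegoView.lift_mulVec` below. -/
structure LegoView {V' E' V E : Type*} {H : Multigraph V' E'} {G : Multigraph V E}
    (c : Covering H G) {ℓ : ℕ} (cut : Fin ℓ ↪ E) (W : Type*) where
  pos : V' ≃ W × V
  pos_snd : ∀ x, (pos x).2 = c.vert x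
  shift : Fin ℓ → Equiv.Perm W
  block : ∀ e', c.edge e' ∉ Set.range cut → (pos (H.src e')).1 = (pos (H.tgt e')).1
  glue : ∀ i e', c.edge e' = cut i → (pos (H.tgt e')).1 = shift i (pos (H.src e')).1

/-- The skeleton of a lego block picture: the `2 * ℓ`-regular multigraph on `W` whose edge `(u, i)`
joins `u` to `u + e_i`. The edge `(u, i)` is weighted by `A_i` when traversed from `u` to `u + e_i`,
and by `A_i^*` when traversed in the other direction. -/
def LegoView.skeleton {V' E' V E : Type*} {H : Multigraph V' E'} {G : Multigraph V E}
    {c : Covering H G} {ℓ : ℕ} {cut : Fin ℓ ↪ E} {W : Type*} (L : LegoView c cut W) :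
    Multigraph W (W × Fin ℓ) where
  src e := e.1
  tgt e := L.shift e.2 e.1

/-- The second largest eigenvalue, counted with multiplicity, of a Hermitian matrix of size at
least two. -/
noncomputable def lambdaTwo {n : Type*} [Fintype n] [DecidableEq n] {M : Matrix n n ℂ}
    (hM : M.IsHermitian) (h : 1 < Fintype.card n) : ℝ :=
  hM.eigenvalues₀ ⟨1, h⟩

/-- `⟨M y, y⟩`, with the inner product of `ℂ^p`. (The real part is taken only to obtain a real
number: the value is real for all matrices and vectors to which this is applied here, since their
entries are real.) -/
noncomputable def quadForm {n : Type*} [Fintype n] [DecidableEq n] (M : Matrix n n ℂ)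
    (y : EuclideanSpace ℂ n) : ℝ :=
  (inner ℂ y (Matrix.toEuclideanLin M y)).re

theorem JacobiData.matrix_mulVec {V E : Type*} [Fintype V] [DecidableEq V] [Fintype E]
    {G : Multigraph V E} (J : JacobiData G) (f : V → ℂ) (v : V) :
    J.matrix.mulVec f v = (J.b v : ℂ) * f v +
      (∑ e, (if G.src e = v then (J.a e : ℂ) * f (G.tgt e) else 0) +
        ∑ e, (if G.tgt e = v then (J.a e : ℂ) * f (G.src e) else 0)) := by
  simp only [Matrix.mulVec, dotProduct, JacobiData.matrix, add_mul, Finset.sum_add_distrib,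
    Finset.sum_mul, ite_and, ite_mul, zero_mul]
  congr 1
  · simp
  · congr 1
    · rw [Finset.sum_comm]
      refine Finset.sum_congr rfl fun e _ => ?_
      by_cases h : G.src e = v <;> simp [h]
    · rw [Finset.sum_comm]
      refine Finset.sum_congr rfl fun e _ => ?_
      by_cases h : G.tgt e = v <;> simp [h]

theorem blockA_mulVec {V E : Type*} [Fintype V] [DecidableEq V] {G : Multigraph V E}
    (J : JacobiData G) {ℓ : ℕ} (cut : Fin ℓ ↪ E) (i : Fin ℓ) (f : V → ℂ) (v : V) :
    (blockA J cut i).mulVec f v =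
      if G.src (cut i) = v then (J.a (cut i) : ℂ) * f (G.tgt (cut i)) else 0 := by
  simp only [Matrix.mulVec, dotProduct, blockA, ite_and, ite_mul, zero_mul]
  by_cases h : G.src (cut i) = v <;> simp [h]

theorem blockA_conjTranspose_mulVec {V E : Type*} [Fintype V] [DecidableEq V]
    {G : Multigraph V E} (J : JacobiData G) {ℓ : ℕ} (cut : Fin ℓ ↪ E) (i : Fin ℓ) (f : V → ℂ)
    (v : V) :
    (blockA J cut i).conjTranspose.mulVec f v =
      if G.tgt (cut i) = v then (J.a (cut i) : ℂ) * f (G.src (cut i)) else 0 := by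
  simp only [Matrix.mulVec, dotProduct, blockA, Matrix.conjTranspose_apply]
  by_cases h : G.tgt (cut i) = v
  · simp only [h, and_true, if_true]
    rw [Finset.sum_eq_single (G.src (cut i))]
    · simp
    · intro w _ hw; simp [Ne.symm hw]
    · simp
  · simp [h]

/-- A sum over the edges splits into the uncut and the cut edges. -/
theorem sum_edges_split {E : Type*} [Fintype E] {ℓ : ℕ} (cut : Fin ℓ ↪ E)
    [Fintype ((Set.range cut)ᶜ : Set E)] (F : E → ℂ) :
    ∑ e, F e = ∑ e : ((Set.range cut)ᶜ : Set E), F e + ∑ i, F (cut i) := by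
  classical
  rw [← Finset.sum_compl_add_sum (Finset.univ.map cut) F, Finset.sum_map]
  congr 1
  refine (Finset.sum_subtype _ (fun e => ?_) F)
  simp

/-- In a lego block picture the lifted Jacobi matrix acts on `x : W → V → ℂ` by
`(J x)_u = B x_u + ∑ i, (A_i x_{u + e_i} + A_i^* x_{u - e_i})`. -/
theorem LegoView.lift_mulVec {V' E' V E : Type*} [Fintype V'] [DecidableEq V'] [Fintype E']
    [Fintype V] [DecidableEq V] [Fintype E] {H : Multigraph V' E'} {G : Multigraph V E}
    {c : Covering H G} {ℓ : ℕ} {cut : Fin ℓ ↪ E} {W : Type*} (L : LegoView c cut W)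
    (J : JacobiData G) (x : W → V → ℂ) (u : W) (v : V) :
    (J.lift c).matrix.mulVec (fun z => x (L.pos z).1 (L.pos z).2) (L.pos.symm (u, v)) =
      ((blockB J cut).mulVec (x u) +
        ∑ i, ((blockA J cut i).mulVec (x (L.shift i u)) +
          (blockA J cut i).conjTranspose.mulVec (x ((L.shift i).symm u)))) v := by
  classical
  have : Fintype ((Set.range cut)ᶜ : Set E) := Fintype.ofFinite _
  have hv : c.vert (L.pos.symm (u, v)) = v := by rw [← L.pos_snd]; simp
  -- the values of `x` seen across an edge over `e`
  let P : E → ℂ := fun e =>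
    if h : ∃ i, cut i = e then x (L.shift h.choose u) (G.tgt e) else x u (G.tgt e)
  let Q : E → ℂ := fun e =>
    if h : ∃ i, cut i = e then x ((L.shift h.choose).symm u) (G.src e) else x u (G.src e)
  have hPi : ∀ i, P (cut i) = x (L.shift i u) (G.tgt (cut i)) := fun i => by
    have h : ∃ k, cut k = cut i := ⟨i, rfl⟩
    have : h.choose = i := cut.injective h.choose_spec
    simp only [P, dif_pos h, this]
  have hQi : ∀ i, Q (cut i) = x ((L.shift i).symm u) (G.src (cut i)) := fun i => by
    have h : ∃ k, cut k = cut i := ⟨i, rfl⟩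
    have : h.choose = i := cut.injective h.choose_spec
    simp only [Q, dif_pos h, this]
  have hPn : ∀ e : ((Set.range cut)ᶜ : Set E), P e = x u (G.tgt e) := fun e =>
    dif_neg fun h => e.2 h
  have hQn : ∀ e : ((Set.range cut)ᶜ : Set E), Q e = x u (G.src e) := fun e =>
    dif_neg fun h => e.2 h
  have h1 : ∑ e', (if H.src e' = L.pos.symm (u, v) then
        (J.a (c.edge e') : ℂ) * x (L.pos (H.tgt e')).1 (L.pos (H.tgt e')).2 else 0) =
      ∑ e, (if G.src e = v then (J.a e : ℂ) * P e else 0) := by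
    rw [← Finset.sum_filter, ← Finset.sum_filter]
    refine Finset.sum_bij (fun e' _ => c.edge e') ?_ ?_ ?_ ?_
    · intro e' he'
      simp only [Finset.mem_filter, Finset.mem_univ, true_and] at he' ⊢
      rw [← c.vert_src, he', hv]
    · intro a ha b hb hab
      simp only [Finset.mem_filter, Finset.mem_univ, true_and] at ha hb
      exact (c.lift_src (L.pos.symm (u, v)) (c.edge a) (by rw [← c.vert_src, ha])).unique
        ⟨rfl, ha⟩ ⟨hab.symm, hb⟩
    · intro e he
      simp only [Finset.mem_filter, Finset.mem_univ, true_and] at he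
      obtain ⟨e', ⟨h1, h2⟩, -⟩ := c.lift_src (L.pos.symm (u, v)) e (by rw [he, hv])
      exact ⟨e', by simp [h2], h1⟩
    · intro e' he'
      simp only [Finset.mem_filter, Finset.mem_univ, true_and] at he'
      congr 1
      rw [L.pos_snd, c.vert_tgt]
      by_cases h : ∃ i, cut i = c.edge e'
      · obtain ⟨i, hi⟩ := h
        rw [← hi, hPi, L.glue i e' hi.symm, he']; simp
      · rw [← L.block e' h, he']; simp [P, h]
  have h2 : ∑ e', (if H.tgt e' = L.pos.symm (u, v) then
        (J.a (c.edge e') : ℂ) * x (L.pos (H.src e')).1 (L.pos (H.src e')).2 else 0) =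
      ∑ e, (if G.tgt e = v then (J.a e : ℂ) * Q e else 0) := by
    rw [← Finset.sum_filter, ← Finset.sum_filter]
    refine Finset.sum_bij (fun e' _ => c.edge e') ?_ ?_ ?_ ?_
    · intro e' he'
      simp only [Finset.mem_filter, Finset.mem_univ, true_and] at he' ⊢
      rw [← c.vert_tgt, he', hv]
    · intro a ha b hb hab
      simp only [Finset.mem_filter, Finset.mem_univ, true_and] at ha hb
      exact (c.lift_tgt (L.pos.symm (u, v)) (c.edge a) (by rw [← c.vert_tgt, ha])).unique
        ⟨rfl, ha⟩ ⟨hab.symm, hb⟩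
    · intro e he
      simp only [Finset.mem_filter, Finset.mem_univ, true_and] at he
      obtain ⟨e', ⟨h1, h2⟩, -⟩ := c.lift_tgt (L.pos.symm (u, v)) e (by rw [he, hv])
      exact ⟨e', by simp [h2], h1⟩
    · intro e' he'
      simp only [Finset.mem_filter, Finset.mem_univ, true_and] at he'
      congr 1
      rw [L.pos_snd, c.vert_src]
      by_cases h : ∃ i, cut i = c.edge e'
      · obtain ⟨i, hi⟩ := h
        have := L.glue i e' hi.symm
        replace this : u = L.shift i (L.pos (H.src e')).1 := by simpa [he'] using this
        rw [← hi, hQi]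
        congr 1
        rw [Equiv.eq_symm_apply, ← this]
      · rw [L.block e' h, he']; simp [Q, h]
  have hB := JacobiData.matrix_mulVec (J.restrict (Set.range cut)ᶜ) (x u) v
  have hBB : blockB J cut = (J.restrict (Set.range cut)ᶜ).matrix := by
    unfold blockB; congr!
  rw [JacobiData.matrix_mulVec]
  simp only [JacobiData.lift]
  rw [h1, h2, sum_edges_split cut, sum_edges_split cut]
  simp only [Pi.add_apply, Finset.sum_apply, hBB, hB, blockA_mulVec, blockA_conjTranspose_mulVec,
    hPi, hQi, hPn, hQn, Finset.sum_add_distrib]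
  simp only [JacobiData.restrict, Multigraph.restrict, hv, Equiv.apply_symm_apply]
  have key : ∀ p q r s t : ℂ, p + (q + r + (s + t)) = p + (q + s) + (r + t) := by
    intros; ring
  rw [key]
  congr!

/-- In a tree, a vertex has at most one neighbor that is closer to a given root. -/
theorem tree_parent_unique {V : Type*} {T : SimpleGraph V} (hT : T.IsTree) {v₀ v w w' : V}
    (hw : T.Adj w v) (hw' : T.Adj w' v) (h : T.dist v₀ v = T.dist v₀ w + 1)
    (h' : T.dist v₀ v = T.dist v₀ w' + 1) : w = w' := by
  obtain ⟨p, hp⟩ := hT.connected.exists_walk_length_eq_dist v₀ w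
  obtain ⟨q, hq⟩ := hT.connected.exists_walk_length_eq_dist v₀ w'
  have h1 : (p.concat hw).IsPath := SimpleGraph.Walk.isPath_of_length_eq_dist _ (by
    rw [SimpleGraph.Walk.length_concat, hp, h])
  have h2 : (q.concat hw').IsPath := SimpleGraph.Walk.isPath_of_length_eq_dist _ (by
    rw [SimpleGraph.Walk.length_concat, hq, h'])
  have h3 := (hT.isAcyclic.subsingleton_path v₀ v).elim ⟨_, h1⟩ ⟨_, h2⟩
  have h4 := congrArg (fun z => SimpleGraph.Walk.penultimate z.1) h3
  simpa using h4

/-- In a tree, a vertex different from the root has a neighbor that is closer to the root. -/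
theorem tree_parent_exists {V : Type*} {T : SimpleGraph V} (hT : T.IsTree) {v₀ v : V} {n : ℕ}
    (h : T.dist v₀ v = n + 1) : ∃ w, T.Adj w v ∧ T.dist v₀ w = n := by
  obtain ⟨p, hp⟩ := hT.connected.exists_walk_length_eq_dist v v₀
  cases p with
  | nil => simp at h
  | cons hadj q =>
    rename_i w
    refine ⟨w, hadj.symm, ?_⟩
    have h1 := SimpleGraph.dist_le q.reverse
    rw [SimpleGraph.Walk.length_cons, SimpleGraph.dist_comm, h] at hp
    rw [SimpleGraph.Walk.length_reverse] at h1
    have := hT.dist_eq_dist_add_one_of_adj v₀ hadj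
    omega

/-- A covering of a tree is a disjoint union of copies of the tree. -/
theorem tree_cover_trivial {V X : Type*} {T : SimpleGraph V} (hT : T.IsTree) (v₀ : V)
    (f : X → V) (R : X → X → Prop) (hsymm : ∀ x y, R x y → R y x)
    (hadj : ∀ x y, R x y → T.Adj (f x) (f y))
    (hex : ∀ x w, T.Adj (f x) w → ∃ y, R x y ∧ f y = w)
    (huniq : ∀ x y y', R x y → R x y' → f y = f y' → y = y') :
    ∃ ρ : X → X, (∀ x, f (ρ x) = v₀) ∧ (∀ x y, R x y → ρ x = ρ y) ∧
      (∀ x y, ρ x = ρ y → f x = f y → x = y) ∧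
      ∀ x₀ v, f x₀ = v₀ → ∃ x, f x = v ∧ ρ x = x₀ := by
  classical
  let par : X → X := fun x =>
    if h : ∃ y, R x y ∧ T.dist v₀ (f x) = T.dist v₀ (f y) + 1 then h.choose else x
  have hpar : ∀ x y, R x y → T.dist v₀ (f x) = T.dist v₀ (f y) + 1 → par x = y := by
    intro x y hR hd
    have h : ∃ y, R x y ∧ T.dist v₀ (f x) = T.dist v₀ (f y) + 1 := ⟨y, hR, hd⟩
    have hp : par x = h.choose := dif_pos h
    obtain ⟨h1, h2⟩ := h.choose_spec
    rw [hp]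
    refine huniq x _ _ h1 hR ?_
    exact tree_parent_unique hT (hadj _ _ h1).symm (hadj _ _ hR).symm h2 hd
  have hparex : ∀ x n, T.dist v₀ (f x) = n + 1 → R x (par x) ∧ T.dist v₀ (f (par x)) = n := by
    intro x n hn
    obtain ⟨w, hw, hwn⟩ := tree_parent_exists hT hn
    obtain ⟨y, hy, rfl⟩ := hex x w hw.symm
    rw [hpar x y hy (by omega)]
    exact ⟨hy, hwn⟩
  let ρ : X → X := fun x => par^[T.dist v₀ (f x)] x
  have hρ0 : ∀ x, T.dist v₀ (f x) = 0 → ρ x = x ∧ f x = v₀ := by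
    intro x hx
    refine ⟨by simp [ρ, hx], ?_⟩
    exact (hT.connected.dist_eq_zero_iff.mp hx).symm
  have hρs : ∀ x n, T.dist v₀ (f x) = n + 1 → ρ x = ρ (par x) := by
    intro x n hx
    obtain ⟨-, h2⟩ := hparex x n hx
    simp only [ρ, hx, h2, Function.iterate_succ_apply]
  have hR : ∀ x y, R x y → ρ x = ρ y := by
    intro x y hxy
    rcases hT.dist_eq_dist_add_one_of_adj v₀ (hadj x y hxy) with h | h
    · rw [hρs x _ h, hpar x y hxy h]
    · rw [hρs y _ h, hpar y x (hsymm _ _ hxy) h]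
  refine ⟨ρ, ?_, hR, ?_, ?_⟩
  · suffices h : ∀ n x, T.dist v₀ (f x) = n → f (ρ x) = v₀ from fun x => h _ x rfl
    intro n
    induction n with
    | zero => intro x hx; rw [(hρ0 x hx).1, (hρ0 x hx).2]
    | succ n ih => intro x hx; rw [hρs x n hx]; exact ih _ (hparex x n hx).2
  · suffices h : ∀ n x y, T.dist v₀ (f x) = n → ρ x = ρ y → f x = f y → x = y from
      fun x y => h _ x y rfl
    intro n
    induction n with
    | zero =>
      intro x y hx hr hf
      rwa [(hρ0 x hx).1, (hρ0 y (hf ▸ hx)).1] at hr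
    | succ n ih =>
      intro x y hx hr hf
      have hy : T.dist v₀ (f y) = n + 1 := hf ▸ hx
      obtain ⟨hx1, hx2⟩ := hparex x n hx
      obtain ⟨hy1, hy2⟩ := hparex y n hy
      have hff : f (par x) = f (par y) := by
        refine tree_parent_unique hT (v₀ := v₀) (v := f x) (hadj _ _ hx1).symm ?_ (by omega)
          (by omega)
        rw [hf]; exact (hadj _ _ hy1).symm
      have hz := ih _ _ hx2 (by rw [← hρs x n hx, ← hρs y n hy, hr]) hff
      refine huniq (par x) x y (hsymm _ _ hx1) ?_ hf
      rw [hz]; exact hsymm _ _ hy1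
  · intro x₀ v h0
    suffices h : ∀ n v, T.dist v₀ v = n → ∃ x, f x = v ∧ ρ x = x₀ from h _ v rfl
    intro n
    induction n with
    | zero =>
      intro v hv
      have hv' : v₀ = v := hT.connected.dist_eq_zero_iff.mp hv
      exact ⟨x₀, h0.trans hv', (hρ0 x₀ (by rw [h0, SimpleGraph.dist_self])).1⟩
    | succ n ih =>
      intro v hv
      obtain ⟨w, hw, hwn⟩ := tree_parent_exists hT hv
      obtain ⟨x, rfl, hx⟩ := ih w hwn
      obtain ⟨y, hy, rfl⟩ := hex x v hw
      exact ⟨y, rfl, by rw [← hR x y hy, hx]⟩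

/-- Every covering of `G` has a lego block picture. -/
theorem exists_legoView {V' E' V E : Type*} {H : Multigraph V' E'} {G : Multigraph V E}
    (c : Covering H G) {ℓ : ℕ} (cut : Fin ℓ ↪ E) (hcut : IsTreeCut G cut) :
    ∃ W : Set V', Nonempty (LegoView c cut W) := by
  classical
  obtain ⟨v₀⟩ := hcut.tree.connected.nonempty
  let R : V' → V' → Prop := fun x y => ∃ e', c.edge e' ∉ Set.range cut ∧
    ((H.src e' = x ∧ H.tgt e' = y) ∨ (H.src e' = y ∧ H.tgt e' = x))
  have hsame : ∀ e₁ e₂, e₁ ∉ Set.range cut → e₂ ∉ Set.range cut →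
      s(G.src e₁, G.tgt e₁) = s(G.src e₂, G.tgt e₂) → e₁ = e₂ := by
    intro e₁ e₂ h₁ h₂ h
    exact congrArg Subtype.val (hcut.no_multi (a₁ := ⟨e₁, h₁⟩) (a₂ := ⟨e₂, h₂⟩) h)
  have hloop : ∀ e, e ∉ Set.range cut → G.src e ≠ G.tgt e := fun e h => hcut.no_loop ⟨e, h⟩
  obtain ⟨ρ, hρ0, hρR, hρinj, hρsurj⟩ := tree_cover_trivial hcut.tree v₀ c.vert R
    (by
      rintro x y ⟨e', h, h'⟩
      exact ⟨e', h, h'.symm⟩)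
    (by
      rintro x y ⟨e', h, ⟨rfl, rfl⟩ | ⟨rfl, rfl⟩⟩
      · rw [c.vert_src, c.vert_tgt]
        exact ⟨hloop _ h, Or.inl ⟨⟨_, h⟩, rfl, rfl⟩⟩
      · rw [c.vert_src, c.vert_tgt]
        exact ⟨(hloop _ h).symm, Or.inr ⟨⟨_, h⟩, rfl, rfl⟩⟩)
    (by
      rintro x w ⟨-, ⟨⟨e, he⟩, h1, h2⟩ | ⟨⟨e, he⟩, h1, h2⟩⟩
      · obtain ⟨e', ⟨h3, h4⟩, -⟩ := c.lift_src x e h1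
        exact ⟨H.tgt e', ⟨e', by rw [h3]; exact he, Or.inl ⟨h4, rfl⟩⟩,
          by rw [c.vert_tgt, h3]; exact h2⟩
      · obtain ⟨e', ⟨h3, h4⟩, -⟩ := c.lift_tgt x e h2
        exact ⟨H.src e', ⟨e', by rw [h3]; exact he, Or.inr ⟨rfl, h4⟩⟩,
          by rw [c.vert_src, h3]; exact h1⟩)
    (by
      rintro x y y' ⟨e₁, h₁, k₁⟩ ⟨e₂, h₂, k₂⟩ hy
      have he : c.edge e₁ = c.edge e₂ := by
        apply hsame _ _ h₁ h₂
        rw [← c.vert_src, ← c.vert_tgt, ← c.vert_src, ← c.vert_tgt]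
        rcases k₁ with ⟨a, b⟩ | ⟨a, b⟩ <;> rcases k₂ with ⟨a', b'⟩ | ⟨a', b'⟩ <;>
          rw [a, b, a', b', hy] <;> simp [Sym2.eq_swap]
      have hl := hloop _ h₁
      rcases k₁ with ⟨a, b⟩ | ⟨a, b⟩ <;> rcases k₂ with ⟨a', b'⟩ | ⟨a', b'⟩
      · have := (c.lift_src x (c.edge e₁) (by rw [← c.vert_src, a])).unique
          ⟨rfl, a⟩ ⟨he.symm, a'⟩
        rw [← b, ← b', this]
      · exact absurd (by rw [← c.vert_src, a, he, ← c.vert_tgt, b']) hl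
      · exact absurd (by rw [← c.vert_tgt, b, he, ← c.vert_src, a']) hl
      · have := (c.lift_tgt x (c.edge e₁) (by rw [← c.vert_tgt, b])).unique
          ⟨rfl, b⟩ ⟨he.symm, b'⟩
        rw [← a, ← a', this])
  refine ⟨{x | c.vert x = v₀}, ⟨?_⟩⟩
  let pos : V' ≃ {x | c.vert x = v₀} × V := Equiv.ofBijective (fun x => (⟨ρ x, hρ0 x⟩, c.vert x))
    ⟨fun x y h => by
        simp only [Prod.mk.injEq, Subtype.mk.injEq] at h
        exact hρinj x y h.1 h.2,
      fun z => by
        obtain ⟨x, h1, h2⟩ := hρsurj z.1 z.2 z.1.2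
        exact ⟨x, Prod.ext (Subtype.ext h2) h1⟩⟩
  let s : ∀ i, {e' // c.edge e' = cut i} ≃ {x | c.vert x = v₀} := fun i =>
    Equiv.ofBijective (fun e' => ⟨ρ (H.src e'.1), hρ0 _⟩)
      ⟨fun e₁ e₂ h => by
          have hx : H.src e₁.1 = H.src e₂.1 := hρinj _ _ (congrArg Subtype.val h) (by
            rw [c.vert_src, c.vert_src, e₁.2, e₂.2])
          exact Subtype.ext ((c.lift_src (H.src e₂.1) (cut i) (by
            rw [c.vert_src, e₂.2])).unique ⟨e₁.2, hx⟩ ⟨e₂.2, rfl⟩),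
        fun z => by
          obtain ⟨x, h1, h2⟩ := hρsurj z.1 (G.src (cut i)) z.2
          obtain ⟨e', ⟨h3, h4⟩, -⟩ := c.lift_src x (cut i) h1.symm
          exact ⟨⟨e', h3⟩, Subtype.ext (by simp only [h4, h2])⟩⟩
  let t : ∀ i, {e' // c.edge e' = cut i} ≃ {x | c.vert x = v₀} := fun i =>
    Equiv.ofBijective (fun e' => ⟨ρ (H.tgt e'.1), hρ0 _⟩)
      ⟨fun e₁ e₂ h => by
          have hx : H.tgt e₁.1 = H.tgt e₂.1 := hρinj _ _ (congrArg Subtype.val h) (by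
            rw [c.vert_tgt, c.vert_tgt, e₁.2, e₂.2])
          exact Subtype.ext ((c.lift_tgt (H.tgt e₂.1) (cut i) (by
            rw [c.vert_tgt, e₂.2])).unique ⟨e₁.2, hx⟩ ⟨e₂.2, rfl⟩),
        fun z => by
          obtain ⟨x, h1, h2⟩ := hρsurj z.1 (G.tgt (cut i)) z.2
          obtain ⟨e', ⟨h3, h4⟩, -⟩ := c.lift_tgt x (cut i) h1.symm
          exact ⟨⟨e', h3⟩, Subtype.ext (by simp only [h4, h2])⟩⟩
  exact
    { pos := pos
      pos_snd := fun x => rfl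
      shift := fun i => (s i).symm.trans (t i)
      block := fun e' h => Subtype.ext (hρR _ _ ⟨e', h, Or.inl ⟨rfl, rfl⟩⟩)
      glue := fun i e' h => by
        have h1 : (pos (H.src e')).1 = s i ⟨e', h⟩ := rfl
        rw [h1, Equiv.trans_apply, Equiv.symm_apply_apply]
        rfl }

/-!
The second eigenvalue is bounded from below by the min-max principle: it suffices to find two
nonzero vectors, orthogonal and not interacting through `J`, with Rayleigh quotients at least the
right-hand side (`le_lambdaTwo`). Both vectors have the form `u ↦ g u • y` (`blockVec`), where `g`
is a nonnegative function on the skeleton supported near one of the two given edges; with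
`α i = ⟨A_i y, y⟩ ≥ 0` the quadratic form of `J` is then
`⟨B y, y⟩ ∑ u, g u ^ 2 + 2 ∑ i, α i * ∑ u, g u * g (u + e_i)` (`re_inner_blockVec_lift_self`).

To choose `g`, put `q = d - 1`. On the universal cover of the skeleton, a `d`-regular tree, take the
radial function with value `q ^ (-k / 2)` on the vertices at distance `k < r` from a lift of the
given edge, and let `g u` be the `ℓ²`-norm of its values over `u` (`testFun`). This keeps the norm,
and by the Cauchy-Schwarz inequality over each edge (`le_testFun_mul_testFun`) it does not decrease
the form, because the weights `α i` are nonnegative. So cycles of the skeleton do no harm. The tree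
itself is not needed: the number of tree vertices at level `k` over `u` whose parent edge is a given
directed edge is the number of non-backtracking walks with that last step, which obeys a
one-step recursion (`walkCount`).

On the tree, all `d` directions but the one that leads back to the parent continue to the next
level. Therefore the average of `α` over the edges that lead to level `k` deviates from the mean
`m = ⟨A y, y⟩ / d` by exactly `(-1 / q) ^ k * (α j - m)` (`sum_walkCount`). The sum of these
deviations is an alternating geometric series, multiplied by `2 √q`. Together with the contribution
of the root edge this gives a multiple of `α j - m` with a factor in `[-1, 1]`, whence the absolute
value in the constant; the remaining part of the constant comes from the root edge, which carries
weight `1` in place of `2 √q` (`rayleigh_testFun_ge`).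
-/

/-! ### Non-backtracking walks -/

section Walks

variable {W ι : Type*} [Fintype ι]

/-- The step `u ↦ u + e_i` (for `true`) or `u ↦ u - e_i` (for `false`). -/
def walkStep (σ : ι → Equiv.Perm W) : Bool → ι → Equiv.Perm W
  | true, i => σ i
  | false, i => (σ i).symm

open Classical in
/-- The number of non-backtracking walks that start by traversing the edge between `p` and
`σ j p`, in either direction, then make `k` more steps, end in `u`, and have `(b, i)` as their last
step, as a real number. Equivalently, in the universal cover of the skeleton, the number of
vertices over `u` at distance `k` from a given edge over `(p, j)` that are joined by the step
`(b, i)` to their parent (for `k = 0`, to the other end of that edge). -/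
noncomputable def walkCount (σ : ι → Equiv.Perm W) (j : ι) (p : W) : ℕ → Bool → ι → W → ℝ
  | 0, b, i, u => if i = j ∧ u = (if b then σ j p else p) then 1 else 0
  | k + 1, b, i, u =>
    ∑ b', ∑ i', walkCount σ j p k b' i' (walkStep σ (!b) i u) -
      walkCount σ j p k (!b) i (walkStep σ (!b) i u)

/-- The number of non-backtracking walks that start by traversing the edge between `p` and
`σ j p`, then make `k` more steps, and end in `u`. -/
noncomputable def walkTotal (σ : ι → Equiv.Perm W) (j : ι) (p : W) (k : ℕ) (u : W) : ℝ :=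
  ∑ b, ∑ i, walkCount σ j p k b i u

variable (σ : ι → Equiv.Perm W) (j : ι) (p : W)

theorem walkCount_le_walkTotal {k : ℕ} (h : ∀ b i u, 0 ≤ walkCount σ j p k b i u) (b : Bool)
    (i : ι) (u : W) : walkCount σ j p k b i u ≤ walkTotal σ j p k u :=
  le_trans (Finset.single_le_sum (f := fun i => walkCount σ j p k b i u) (fun i _ => h b i u)
      (Finset.mem_univ i))
    (Finset.single_le_sum (f := fun b => ∑ i, walkCount σ j p k b i u)
      (fun b _ => Finset.sum_nonneg fun i _ => h b i u) (Finset.mem_univ b))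

theorem walkCount_nonneg (k : ℕ) : ∀ b i u, 0 ≤ walkCount σ j p k b i u := by
  induction k with
  | zero =>
    intro b i u
    rw [walkCount]
    by_cases h : i = j ∧ u = (if b then σ j p else p) <;> simp only [h, if_false] <;> norm_num
  | succ k ih =>
    intro b i u
    exact sub_nonneg.2 (walkCount_le_walkTotal σ j p ih _ _ _)

theorem walkTotal_nonneg (k : ℕ) (u : W) : 0 ≤ walkTotal σ j p k u :=
  Finset.sum_nonneg fun b _ => Finset.sum_nonneg fun i _ => walkCount_nonneg σ j p k b i u

/-- Of the walks that end in `u`, those that arrived from `u + e_i` by the step `(false, i)` cannot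
continue with the step `(true, i)`, and all the others can. -/
theorem walkTotal_eq_forward (k : ℕ) (i : ι) (u : W) :
    walkTotal σ j p k u =
      walkCount σ j p k false i u + walkCount σ j p (k + 1) true i (σ i u) := by
  simp [walkTotal, walkCount, walkStep]

theorem walkTotal_eq_backward (k : ℕ) (i : ι) (u : W) :
    walkTotal σ j p k (σ i u) =
      walkCount σ j p k true i (σ i u) + walkCount σ j p (k + 1) false i u := by
  simp [walkTotal, walkCount, walkStep]

theorem walkCount_zero_eq (i : ι) (u : W) :
    walkCount σ j p 0 true i (σ i u) = walkCount σ j p 0 false i u := by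
  by_cases h : i = j
  · subst h; by_cases hu : u = p <;> simp [walkCount, hu]
  · simp [walkCount, h]

/-- Walks of length `k` stay within distance `k` of the ends of the initial edge. -/
theorem exists_edist_le_of_walkTotal_ne_zero {G : SimpleGraph W}
    (hG : ∀ i u, G.edist u (σ i u) ≤ 1) (k : ℕ) :
    ∀ u, walkTotal σ j p k u ≠ 0 → ∃ x ∈ ({p, σ j p} : Set W), G.edist x u ≤ k := by
  have hstep : ∀ b i u, G.edist (walkStep σ b i u) u ≤ 1 := by
    rintro (_ | _) i u
    · simpa [walkStep] using hG i ((σ i).symm u)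
    · rw [SimpleGraph.edist_comm]; exact hG i u
  have hne : ∀ k u, walkTotal σ j p k u ≠ 0 → ∃ b i, walkCount σ j p k b i u ≠ 0 := by
    intro k u hu
    by_contra! hc
    exact hu (by simp [walkTotal, hc])
  induction k with
  | zero =>
    intro u hu
    obtain ⟨b, i, h⟩ := hne _ _ hu
    refine ⟨u, ?_, by simp⟩
    simp only [walkCount, ne_eq, ite_eq_right_iff, not_forall] at h
    obtain ⟨⟨-, rfl⟩, -⟩ := h
    cases b <;> simp
  | succ k ih =>
    intro u hu
    obtain ⟨b, i, h⟩ := hne _ _ hu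
    have : walkTotal σ j p k (walkStep σ (!b) i u) ≠ 0 := by
      intro h0
      have h1 := walkCount_le_walkTotal σ j p (walkCount_nonneg σ j p k) (!b) i
        (walkStep σ (!b) i u)
      have h2 := walkCount_nonneg σ j p k (!b) i (walkStep σ (!b) i u)
      have h3 : walkCount σ j p (k + 1) b i u =
        walkTotal σ j p k (walkStep σ (!b) i u) - walkCount σ j p k (!b) i (walkStep σ (!b) i u) :=
        rfl
      exact h (by linarith)
    obtain ⟨x, hx, hxu⟩ := ih _ this
    refine ⟨x, hx, (G.edist_triangle (v := walkStep σ (!b) i u)).trans ?_⟩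
    push_cast
    exact add_le_add hxu (hstep _ _ _)

section Mass

variable [Fintype W]

open Classical in
/-- The number of walks of length `k` with last step `(b, i)`. Since the reverse of `(b, i)` is the
only step that may not follow, this obeys `m (k + 1) (b, i) = N k - m k (-(b, i))`, where
`N k = 2 q ^ k` is the number of all walks of length `k`; deviations from the mean are thus
multiplied by `-1` in each step, and become negligible relative to `N k`. -/
theorem sum_walkCount (k : ℕ) : ∀ b i,
    ∑ u, walkCount σ j p k b i u = (2 * Fintype.card ι - 1 : ℝ) ^ k / Fintype.card ι +
      (-1) ^ k * ((if i = j then 1 else 0) - 1 / (Fintype.card ι : ℝ)) := by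
  have hι : (Fintype.card ι : ℝ) ≠ 0 := by
    have := Fintype.card_pos_iff.2 ⟨j⟩
    positivity
  induction k with
  | zero =>
    intro b i
    by_cases h : i = j <;> simp [walkCount, h]
  | succ k ih =>
    intro b i
    simp only [walkCount, Finset.sum_sub_distrib]
    rw [Equiv.sum_comp (walkStep σ (!b) i) (fun u => walkCount σ j p k (!b) i u),
      Equiv.sum_comp (walkStep σ (!b) i) (fun u => ∑ b', ∑ i', walkCount σ j p k b' i' u),
      Finset.sum_comm]
    simp_rw [Finset.sum_comm (s := (Finset.univ : Finset W)), ih]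
    simp only [Finset.sum_add_distrib, ← Finset.mul_sum, Finset.sum_sub_distrib,
      Finset.sum_const, Finset.card_univ, nsmul_eq_mul, Fintype.card_bool, Finset.sum_ite_eq',
      Finset.mem_univ, if_true]
    field_simp
    push_cast
    ring

theorem sum_walkTotal (k : ℕ) :
    ∑ u, walkTotal σ j p k u = 2 * (2 * Fintype.card ι - 1 : ℝ) ^ k := by
  have hι : (Fintype.card ι : ℝ) ≠ 0 := by
    have := Fintype.card_pos_iff.2 ⟨j⟩
    positivity
  classical
  simp only [walkTotal]
  rw [Finset.sum_comm]
  simp_rw [Finset.sum_comm (s := (Finset.univ : Finset W)), sum_walkCount]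
  simp only [Finset.sum_add_distrib, ← Finset.mul_sum, Finset.sum_sub_distrib,
    Finset.sum_const, Finset.card_univ, nsmul_eq_mul, Fintype.card_bool, Finset.sum_ite_eq',
    Finset.mem_univ, if_true]
  field_simp
  push_cast
  ring

end Mass

/-! ### The test function -/

/-- The test function of radius `n`: the `ℓ²`-norm, over each fiber of the universal cover, of the
radial function with value `q ^ (-k / 2)` at distance `k ≤ n` from an edge over `(p, j)`, where
`q + 1` is the degree. -/
noncomputable def testFun (n : ℕ) (u : W) : ℝ :=
  √(∑ k ∈ Finset.range (n + 1), ((2 * Fintype.card ι - 1 : ℝ)⁻¹) ^ k * walkTotal σ j p k u)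

theorem exists_edist_le_of_testFun_ne_zero {G : SimpleGraph W}
    (hG : ∀ i u, G.edist u (σ i u) ≤ 1) {n : ℕ} {u : W} (hu : testFun σ j p n u ≠ 0) :
    ∃ x ∈ ({p, σ j p} : Set W), G.edist x u ≤ n := by
  by_contra! hc
  refine hu ?_
  rw [testFun, Finset.sum_eq_zero, Real.sqrt_zero]
  intro k hk
  by_contra h
  obtain ⟨x, hx, hxu⟩ := exists_edist_le_of_walkTotal_ne_zero σ j p hG k u (right_ne_zero_of_mul h)
  refine absurd (hc x hx) (not_lt.2 (hxu.trans ?_))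
  exact_mod_cast Nat.lt_succ_iff.1 (Finset.mem_range.1 hk)

/-- The Cauchy-Schwarz inequality for sums, in incremental form. -/
theorem add_le_sqrt_mul_sqrt {P X Y s x y : ℝ} (hX : 0 ≤ X) (hY : 0 ≤ Y) (hx : 0 ≤ x) (hy : 0 ≤ y)
    (h : P ≤ √X * √Y) (h' : s ≤ √x * √y) : P + s ≤ √(X + x) * √(Y + y) := by
  refine (add_le_add h h').trans ?_
  rw [← Real.sqrt_mul (add_nonneg hX hx)]
  apply Real.le_sqrt_of_sq_le
  have h1 := Real.sq_sqrt hX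
  have h2 := Real.sq_sqrt hY
  have h3 := Real.sq_sqrt hx
  have h4 := Real.sq_sqrt hy
  nlinarith [sq_nonneg (√X * √y - √Y * √x)]

/-- A purely numerical form of the comparison between the universal cover and its quotient along one
edge: `a k` and `b k` are the numbers of lifts of the edge that join levels `k - 1` and `k` and are
traversed forwards and backwards, respectively, when moving away from the root edge; `a 0 = b 0` is
the number of root edges among the lifts. -/
theorem cauchySchwarz_levels {q : ℝ} (hq : 0 < q) {a b : ℕ → ℝ} (ha : ∀ k, 0 ≤ a k)
    (hb : ∀ k, 0 ≤ b k) (h0 : a 0 = b 0) (n : ℕ) :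
    a 0 + √q * ∑ k ∈ Finset.range n, q⁻¹ ^ (k + 1) * (a (k + 1) + b (k + 1)) ≤
      √(∑ k ∈ Finset.range (n + 1), q⁻¹ ^ k * (b k + a (k + 1))) *
        √(∑ k ∈ Finset.range (n + 1), q⁻¹ ^ k * (a k + b (k + 1))) := by
  -- a lift between levels `k` and `k + 1` contributes the geometric mean of the two weights
  have hmean : ∀ k t, 0 ≤ t →
      √q * (q⁻¹ ^ (k + 1) * t) ≤ √(q⁻¹ ^ (k + 1) * t) * √(q⁻¹ ^ k * t) := by
    intro k t ht
    rw [← Real.sqrt_mul (by positivity)]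
    apply Real.le_sqrt_of_sq_le
    rw [mul_pow, Real.sq_sqrt hq.le]
    apply le_of_eq
    have hqq : q * q⁻¹ = 1 := mul_inv_cancel₀ hq.ne'
    linear_combination (q⁻¹ * (q⁻¹ ^ k * t) ^ 2) * hqq
  -- the part of the sums that stops at the weight `q⁻¹ ^ n` of the lifts from below
  have key : a 0 + √q * ∑ k ∈ Finset.range n, q⁻¹ ^ (k + 1) * (a (k + 1) + b (k + 1)) ≤
      √(b 0 + ∑ k ∈ Finset.range n, (q⁻¹ ^ (k + 1) * b (k + 1) + q⁻¹ ^ k * a (k + 1))) *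
        √(a 0 + ∑ k ∈ Finset.range n, (q⁻¹ ^ k * b (k + 1) + q⁻¹ ^ (k + 1) * a (k + 1))) := by
    induction n with
    | zero => simp [← h0, Real.mul_self_sqrt (ha 0)]
    | succ n ih =>
      have h1 : 0 ≤ ∑ k ∈ Finset.range n, (q⁻¹ ^ (k + 1) * b (k + 1) + q⁻¹ ^ k * a (k + 1)) :=
        Finset.sum_nonneg fun k _ => by have := ha (k + 1); have := hb (k + 1); positivity
      have h2 : 0 ≤ ∑ k ∈ Finset.range n, (q⁻¹ ^ k * b (k + 1) + q⁻¹ ^ (k + 1) * a (k + 1)) :=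
        Finset.sum_nonneg fun k _ => by have := ha (k + 1); have := hb (k + 1); positivity
      have ha0 := ha 0
      have hb0 := hb 0
      have han := ha (n + 1)
      have hbn := hb (n + 1)
      have hstep := add_le_sqrt_mul_sqrt (by positivity) (by positivity) (by positivity)
        (by positivity) (add_le_sqrt_mul_sqrt (by positivity) (by positivity) (by positivity)
          (by positivity) ih (hmean n _ hbn))
        ((hmean n _ han).trans_eq (mul_comm _ _))
      simp only [Finset.sum_range_succ, mul_add, add_assoc] at hstep ⊢
      linarith
  refine key.trans ?_
  have han := ha (n + 1)
  have hbn := hb (n + 1)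
  gcongr
  · simp only [mul_add, Finset.sum_add_distrib]
    rw [Finset.sum_range_succ' (fun k => q⁻¹ ^ k * b k),
      Finset.sum_range_succ (fun k => q⁻¹ ^ k * a (k + 1))]
    have : 0 ≤ q⁻¹ ^ n * a (n + 1) := by positivity
    simp only [pow_zero, one_mul]
    linarith
  · simp only [mul_add, Finset.sum_add_distrib]
    rw [Finset.sum_range_succ' (fun k => q⁻¹ ^ k * a k),
      Finset.sum_range_succ (fun k => q⁻¹ ^ k * b (k + 1))]
    have : 0 ≤ q⁻¹ ^ n * b (n + 1) := by positivity
    simp only [pow_zero, one_mul]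
    linarith

include j in
theorem degree_sub_one_ge_one : (1 : ℝ) ≤ 2 * Fintype.card ι - 1 := by
  have : 0 < Fintype.card ι := Fintype.card_pos_iff.2 ⟨j⟩
  have : (1 : ℝ) ≤ Fintype.card ι := by exact_mod_cast this
  linarith

theorem le_testFun_mul_testFun (n : ℕ) (i : ι) (u : W) :
    walkCount σ j p 0 false i u + √(2 * Fintype.card ι - 1 : ℝ) * ∑ k ∈ Finset.range n,
        ((2 * Fintype.card ι - 1 : ℝ)⁻¹) ^ (k + 1) *
          (walkCount σ j p (k + 1) true i (σ i u) + walkCount σ j p (k + 1) false i u) ≤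
      testFun σ j p n u * testFun σ j p n (σ i u) := by
  have hq : (0 : ℝ) < 2 * Fintype.card ι - 1 := by linarith [degree_sub_one_ge_one j]
  have h := cauchySchwarz_levels hq (fun k => walkCount_nonneg σ j p k true i (σ i u))
    (fun k => walkCount_nonneg σ j p k false i u) (walkCount_zero_eq σ j p i u) n
  simp only [← walkTotal_eq_forward, ← walkTotal_eq_backward] at h
  rw [walkCount_zero_eq] at h
  exact h

variable [Fintype W]

theorem sum_testFun_sq (n : ℕ) : ∑ u, testFun σ j p n u * testFun σ j p n u = 2 * (n + 1) := by
  have hq : (0 : ℝ) < 2 * Fintype.card ι - 1 := by linarith [degree_sub_one_ge_one j]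
  have h : ∀ u, testFun σ j p n u * testFun σ j p n u =
      ∑ k ∈ Finset.range (n + 1), ((2 * Fintype.card ι - 1 : ℝ)⁻¹) ^ k * walkTotal σ j p k u :=
    fun u => Real.mul_self_sqrt (Finset.sum_nonneg fun k _ => by
      have := walkTotal_nonneg σ j p k u
      positivity)
  simp_rw [h]
  rw [Finset.sum_comm]
  simp_rw [← Finset.mul_sum, sum_walkTotal, inv_pow]
  rw [Finset.sum_congr rfl (g := fun _ => (2 : ℝ)) fun k _ => by field_simp]
  simp [mul_comm]

/-- The energy of the test function for edge weights `α`, with mean `m`. The deviation of the root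
edge from the mean alternates in sign from level to level, which makes its total contribution
bounded. -/
theorem le_sum_testFun_mul_testFun {α : ι → ℝ} (hα : ∀ i, 0 ≤ α i) (n : ℕ) {m : ℝ}
    (hm : m = (∑ i, α i) / Fintype.card ι) :
    α j + 2 * √(2 * Fintype.card ι - 1 : ℝ) * (n * m + (α j - m) *
        ∑ k ∈ Finset.range n, (-(2 * Fintype.card ι - 1 : ℝ)⁻¹) ^ (k + 1)) ≤
      ∑ i, α i * ∑ u, testFun σ j p n u * testFun σ j p n (σ i u) := by
  classical
  have hq : (0 : ℝ) < 2 * Fintype.card ι - 1 := by linarith [degree_sub_one_ge_one j]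
  have hι : (Fintype.card ι : ℝ) ≠ 0 := by
    have := Fintype.card_pos_iff.2 ⟨j⟩
    positivity
  refine le_trans (le_of_eq ?_) (Finset.sum_le_sum fun i _ => mul_le_mul_of_nonneg_left
    (Finset.sum_le_sum fun u _ => le_testFun_mul_testFun σ j p n i u) (hα i))
  simp only [Finset.sum_add_distrib, ← Finset.mul_sum]
  simp_rw [Finset.sum_comm (s := (Finset.univ : Finset W)), ← Finset.mul_sum,
    Finset.sum_add_distrib]
  simp_rw [fun k i => Equiv.sum_comp (σ i) (fun u => walkCount σ j p k true i u), sum_walkCount]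
  set q : ℝ := 2 * Fintype.card ι - 1 with hqdef
  have hlevel : ∀ k i, q⁻¹ ^ (k + 1) * (q ^ (k + 1) / Fintype.card ι +
        (-1) ^ (k + 1) * ((if i = j then 1 else 0) - 1 / (Fintype.card ι : ℝ)) +
      (q ^ (k + 1) / Fintype.card ι +
        (-1) ^ (k + 1) * ((if i = j then 1 else 0) - 1 / (Fintype.card ι : ℝ)))) =
      2 / Fintype.card ι +
        2 * (-q⁻¹) ^ (k + 1) * ((if i = j then 1 else 0) - 1 / (Fintype.card ι : ℝ)) := by
    intro k i
    rw [neg_pow q⁻¹, inv_pow]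
    field_simp
    ring
  simp_rw [hlevel, Finset.sum_add_distrib, ← Finset.sum_mul, ← Finset.mul_sum]
  set S := ∑ k ∈ Finset.range n, (-q⁻¹) ^ (k + 1)
  have h1 : ∑ i, α i * (if i = j then 1 else 0) = α j := by simp
  have h2 : ∑ i, α i = m * Fintype.card ι := by rw [hm]; field_simp
  have h3 : ∀ A B C : ℝ, ∑ i, α i * (A + B * ((if i = j then 1 else 0) - C)) =
      (A - B * C) * ∑ i, α i + B * ∑ i, α i * (if i = j then 1 else 0) := by
    intro A B C
    rw [Finset.mul_sum, Finset.mul_sum, ← Finset.sum_add_distrib]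
    exact Finset.sum_congr rfl fun i _ => by ring
  have h4 : ∑ i, α i * (q ^ 0 / (Fintype.card ι : ℝ) + (-1) ^ 0 *
        ((if i = j then 1 else 0) - 1 / (Fintype.card ι : ℝ)) +
        √q * (∑ k ∈ Finset.range n, 2 / (Fintype.card ι : ℝ) +
          2 * S * ((if i = j then 1 else 0) - 1 / (Fintype.card ι : ℝ)))) =
      ∑ i, α i * ((1 / (Fintype.card ι : ℝ) + √q * n * (2 / (Fintype.card ι : ℝ))) +
        (1 + √q * 2 * S) * ((if i = j then 1 else 0) - 1 / (Fintype.card ι : ℝ))) := by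
    refine Finset.sum_congr rfl fun i _ => ?_
    rw [Finset.sum_const, Finset.card_range, nsmul_eq_mul]
    ring
  refine Eq.trans ?_ h4.symm
  rw [h3, h1, h2]
  field_simp
  ring

end Walks

/-- Partial sums of the alternating geometric series. -/
theorem sum_neg_inv_pow_mem_Icc {q : ℝ} (hq : 1 ≤ q) (n : ℕ) :
    ∑ k ∈ Finset.range n, (-q⁻¹) ^ (k + 1) ∈ Set.Icc (-q⁻¹) 0 := by
  have h0 : 0 < q⁻¹ := by positivity
  have h1 : q⁻¹ ≤ 1 := inv_le_one_of_one_le₀ hq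
  induction n with
  | zero => simpa using h0.le
  | succ n ih =>
    rw [Finset.sum_range_succ']
    simp_rw [pow_succ _ (_ + 1), ← Finset.sum_mul]
    obtain ⟨h2, h3⟩ := ih
    constructor <;> simp only [zero_add, pow_one] <;> nlinarith

/-! ### Min-max with two decoupled test vectors -/

/-- Vectors orthogonal to the leading eigenvector have Rayleigh quotient at most `λ₂`. -/
theorem re_inner_le_lambdaTwo_mul_sq {n : Type*} [Fintype n] [DecidableEq n] {M : Matrix n n ℂ}
    (hM : M.IsHermitian) (h : 1 < Fintype.card n) (z : EuclideanSpace ℂ n)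
    (hz : inner ℂ ((Matrix.isSymmetric_toEuclideanLin_iff.mpr hM).eigenvectorBasis
      finrank_euclideanSpace ⟨0, by omega⟩) z = 0) :
    (inner ℂ z (Matrix.toEuclideanLin M z)).re ≤ lambdaTwo hM h * ‖z‖ ^ 2 := by
  set hT := Matrix.isSymmetric_toEuclideanLin_iff.mpr hM
  set b := hT.eigenvectorBasis finrank_euclideanSpace
  have key : ∀ i, inner ℂ z (b i) * inner ℂ (b i) (Matrix.toEuclideanLin M z) =
      ((hM.eigenvalues₀ i * ‖inner ℂ (b i) z‖ ^ 2 : ℝ) : ℂ) := by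
    intro i
    rw [← hT (b i) z, hT.apply_eigenvectorBasis, inner_smul_left, ← inner_conj_symm z (b i)]
    erw [Complex.conj_ofReal]
    change _ * (((hM.eigenvalues₀ i : ℝ) : ℂ) * inner ℂ (b i) z) = _
    push_cast
    rw [← Complex.conj_mul' (inner ℂ (b i) z)]
    ring
  rw [← b.sum_inner_mul_inner, ← b.sum_sq_norm_inner_right, Finset.mul_sum, Complex.re_sum]
  refine Finset.sum_le_sum fun i _ => ?_
  rw [key, Complex.ofReal_re]
  rcases Nat.eq_zero_or_pos i.1 with hi | hi
  · have hi0 : i = ⟨0, by omega⟩ := Fin.ext hi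
    rw [hi0, hz]; simp
  · exact mul_le_mul_of_nonneg_right (hM.eigenvalues₀_antitone (Fin.mk_le_of_le_val hi))
      (sq_nonneg _)

/-- If two nonzero vectors are orthogonal, do not interact through `M`, and both have Rayleigh
quotient at least `c`, then so has every combination of them, in particular one that is orthogonal
to the leading eigenvector. -/
theorem le_lambdaTwo {n : Type*} [Fintype n] [DecidableEq n] {M : Matrix n n ℂ}
    (hM : M.IsHermitian) (h : 1 < Fintype.card n) {c : ℝ} {x₁ x₂ : EuclideanSpace ℂ n}
    (hx₁ : x₁ ≠ 0) (hx₂ : x₂ ≠ 0) (h₀ : inner ℂ x₁ x₂ = 0)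
    (h₁₂ : inner ℂ x₁ (Matrix.toEuclideanLin M x₂) = 0)
    (h₁ : c * ‖x₁‖ ^ 2 ≤ (inner ℂ x₁ (Matrix.toEuclideanLin M x₁)).re)
    (h₂ : c * ‖x₂‖ ^ 2 ≤ (inner ℂ x₂ (Matrix.toEuclideanLin M x₂)).re) :
    c ≤ lambdaTwo hM h := by
  set T := Matrix.toEuclideanLin M with hTdef
  have hT : T.IsSymmetric := Matrix.isSymmetric_toEuclideanLin_iff.mpr hM
  have h₂₁ : inner ℂ x₂ (T x₁) = 0 := by rw [← hT, ← inner_conj_symm, h₁₂, map_zero]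
  have h₀' : inner ℂ x₂ x₁ = 0 := by rw [← inner_conj_symm, h₀, map_zero]
  set v := (Matrix.isSymmetric_toEuclideanLin_iff.mpr hM).eigenvectorBasis
      finrank_euclideanSpace ⟨0, by omega⟩ with hv
  obtain ⟨α, β, hαβ, hz⟩ : ∃ α β : ℂ, (α ≠ 0 ∨ β ≠ 0) ∧ inner ℂ v (α • x₁ + β • x₂) = 0 := by
    by_cases hv₁ : inner ℂ v x₁ = 0
    · exact ⟨1, 0, Or.inl one_ne_zero, by simp [hv₁]⟩
    · refine ⟨inner ℂ v x₂, -inner ℂ v x₁, Or.inr (neg_ne_zero.2 hv₁), ?_⟩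
      rw [inner_add_right, inner_smul_right, inner_smul_right]; ring
  have hle := re_inner_le_lambdaTwo_mul_sq hM h _ hz
  have hself : ∀ x : EuclideanSpace ℂ n, inner ℂ x x = ((‖x‖ ^ 2 : ℝ) : ℂ) := fun x => by
    rw [inner_self_eq_norm_sq_to_K]; norm_cast
  have hnorm : ‖α • x₁ + β • x₂‖ ^ 2 = ‖α‖ ^ 2 * ‖x₁‖ ^ 2 + ‖β‖ ^ 2 * ‖x₂‖ ^ 2 := by
    have : inner ℂ (α • x₁ + β • x₂) (α • x₁ + β • x₂) =
        ((‖α‖ ^ 2 * ‖x₁‖ ^ 2 + ‖β‖ ^ 2 * ‖x₂‖ ^ 2 : ℝ) : ℂ) := by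
      simp only [inner_add_left, inner_add_right, inner_smul_left, inner_smul_right, h₀, h₀',
        hself x₁, hself x₂]
      push_cast
      rw [← Complex.conj_mul' α, ← Complex.conj_mul' β]; ring
    rw [hself] at this; exact_mod_cast this
  have hquad : (inner ℂ (α • x₁ + β • x₂) (T (α • x₁ + β • x₂))).re =
      ‖α‖ ^ 2 * (inner ℂ x₁ (T x₁)).re + ‖β‖ ^ 2 * (inner ℂ x₂ (T x₂)).re := by
    have : inner ℂ (α • x₁ + β • x₂) (T (α • x₁ + β • x₂)) =
        ((‖α‖ ^ 2 : ℝ) : ℂ) * inner ℂ x₁ (T x₁) + ((‖β‖ ^ 2 : ℝ) : ℂ) * inner ℂ x₂ (T x₂) := by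
      simp only [map_add, map_smul, inner_add_left, inner_add_right, inner_smul_left,
        inner_smul_right, h₁₂, h₂₁]
      push_cast
      rw [← Complex.conj_mul' α, ← Complex.conj_mul' β]; ring
    rw [this, Complex.add_re, Complex.re_ofReal_mul, Complex.re_ofReal_mul]
  have hpos : 0 < ‖α • x₁ + β • x₂‖ ^ 2 := by
    have p₁ : 0 < ‖x₁‖ := norm_pos_iff.2 hx₁
    have p₂ : 0 < ‖x₂‖ := norm_pos_iff.2 hx₂
    rw [hnorm]
    rcases hαβ with hα | hβ
    · have : 0 < ‖α‖ := norm_pos_iff.2 hα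
      positivity
    · have : 0 < ‖β‖ := norm_pos_iff.2 hβ
      positivity
  refine le_of_mul_le_mul_right (le_trans ?_ hle) hpos
  rw [hquad, hnorm]
  calc c * (‖α‖ ^ 2 * ‖x₁‖ ^ 2 + ‖β‖ ^ 2 * ‖x₂‖ ^ 2)
      = ‖α‖ ^ 2 * (c * ‖x₁‖ ^ 2) + ‖β‖ ^ 2 * (c * ‖x₂‖ ^ 2) := by ring
    _ ≤ _ := by gcongr

/-! ### Vectors that are constant multiples of one vector on each copy -/

/-- The vector on the cover whose restriction to the copy `u` is `g u • y`. -/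
noncomputable def blockVec {V' E' V E : Type*} {H : Multigraph V' E'} {G : Multigraph V E}
    {c : Covering H G} {ℓ : ℕ} {cut : Fin ℓ ↪ E} {W : Type*} (L : LegoView c cut W)
    (y : EuclideanSpace ℂ V) (g : W → ℝ) : EuclideanSpace ℂ V' :=
  WithLp.toLp 2 fun z => (g (L.pos z).1 : ℂ) * y (L.pos z).2

section BlockVec

variable {V' E' V E : Type*} [Fintype V'] [Fintype V] {H : Multigraph V' E'} {G : Multigraph V E}
  {c : Covering H G} {ℓ : ℕ} {cut : Fin ℓ ↪ E} {W : Type*} [Fintype W] (L : LegoView c cut W)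
  (y : EuclideanSpace ℂ V)

theorem inner_blockVec_left (g : W → ℝ) (x : EuclideanSpace ℂ V') :
    inner ℂ (blockVec L y g) x =
      ∑ u, (g u : ℂ) * inner ℂ y (WithLp.toLp 2 fun v => x (L.pos.symm (u, v))) := by
  rw [PiLp.inner_apply, ← L.pos.symm.sum_comp, Fintype.sum_prod_type]
  refine Finset.sum_congr rfl fun u _ => ?_
  rw [PiLp.inner_apply, Finset.mul_sum]
  refine Finset.sum_congr rfl fun v _ => ?_
  simp only [blockVec, Equiv.apply_symm_apply, RCLike.inner_apply, map_mul, Complex.conj_ofReal]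
  ring

theorem inner_blockVec (g g' : W → ℝ) :
    inner ℂ (blockVec L y g) (blockVec L y g') = ((∑ u, g u * g' u : ℝ) : ℂ) * inner ℂ y y := by
  rw [inner_blockVec_left]
  push_cast
  rw [Finset.sum_mul]
  refine Finset.sum_congr rfl fun u _ => ?_
  have : (WithLp.toLp 2 fun v => blockVec L y g' (L.pos.symm (u, v)) : EuclideanSpace ℂ V) =
      (g' u : ℂ) • y := by
    ext v; simp [blockVec]
  rw [this, inner_smul_right]; ring

theorem inner_blockVec_lift [DecidableEq V'] [Fintype E'] [DecidableEq V] [Fintype E]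
    (J : JacobiData G) (g g' : W → ℝ) :
    inner ℂ (blockVec L y g) (Matrix.toEuclideanLin (J.lift c).matrix (blockVec L y g')) =
      ((∑ u, g u * g' u : ℝ) : ℂ) * inner ℂ y (Matrix.toEuclideanLin (blockB J cut) y) +
      ∑ i, (((∑ u, g u * g' (L.shift i u) : ℝ) : ℂ) *
          inner ℂ y (Matrix.toEuclideanLin (blockA J cut i) y) +
        ((∑ u, g u * g' ((L.shift i).symm u) : ℝ) : ℂ) *
          inner ℂ y (Matrix.toEuclideanLin (blockA J cut i).conjTranspose y)) := by
  rw [inner_blockVec_left]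
  have : ∀ u, (WithLp.toLp 2 fun v => Matrix.toEuclideanLin (J.lift c).matrix (blockVec L y g')
        (L.pos.symm (u, v)) : EuclideanSpace ℂ V) =
      (g' u : ℂ) • Matrix.toEuclideanLin (blockB J cut) y +
      ∑ i, ((g' (L.shift i u) : ℂ) • Matrix.toEuclideanLin (blockA J cut i) y +
        (g' ((L.shift i).symm u) : ℂ) •
          Matrix.toEuclideanLin (blockA J cut i).conjTranspose y) := by
    intro u
    ext v
    have h := L.lift_mulVec J (fun u => (g' u : ℂ) • (y : V → ℂ)) u v
    simp only [Matrix.mulVec_smul] at h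
    simp only [Matrix.toLpLin_apply, blockVec, PiLp.add_apply, PiLp.smul_apply, WithLp.ofLp_sum,
      Finset.sum_apply]
    exact h.trans (by simp)
  simp only [this, inner_add_right, inner_smul_right, inner_sum]
  push_cast
  simp only [Finset.sum_mul, mul_add, Finset.sum_add_distrib, Finset.mul_sum]
  congr 1
  · exact Finset.sum_congr rfl fun u _ => by ring
  · congr 1 <;>
    · rw [Finset.sum_comm]
      exact Finset.sum_congr rfl fun i _ => Finset.sum_congr rfl fun u _ => by ring

end BlockVec

/-! ### The lower bound -/

section Blocks

variable {V E : Type*} [Fintype V] [DecidableEq V] {G : Multigraph V E} (J : JacobiData G) {ℓ : ℕ}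
  (cut : Fin ℓ ↪ E) (y : EuclideanSpace ℂ V)

theorem quadForm_conjTranspose (M : Matrix V V ℂ) : quadForm M.conjTranspose y = quadForm M y := by
  rw [quadForm, quadForm, Matrix.toEuclideanLin_conjTranspose_eq_adjoint,
    LinearMap.adjoint_inner_right, ← inner_conj_symm, Complex.conj_re]

theorem quadForm_blockSum : quadForm (blockSum J cut) y = 2 * ∑ i, quadForm (blockA J cut i) y := by
  have : quadForm (blockSum J cut) y =
      ∑ i, (quadForm (blockA J cut i) y + quadForm (blockA J cut i).conjTranspose y) := by
    simp only [quadForm, blockSum, map_sum, map_add, LinearMap.sum_apply, LinearMap.add_apply,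
      inner_sum, inner_add_right, Complex.re_sum, Complex.add_re]
  rw [this, Finset.mul_sum]
  exact Finset.sum_congr rfl fun i _ => by rw [quadForm_conjTranspose]; ring

theorem quadForm_blockA_nonneg (hy : ∀ v, 0 ≤ y v) (i : Fin ℓ) :
    0 ≤ quadForm (blockA J cut i) y := by
  refine (Complex.nonneg_iff.1 ?_).1
  rw [PiLp.inner_apply]
  refine Finset.sum_nonneg fun v _ => ?_
  rw [RCLike.inner_apply, Matrix.toLpLin_apply]
  refine mul_nonneg ?_ (star_nonneg_iff.2 (hy v))
  change 0 ≤ (blockA J cut i).mulVec y v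
  rw [blockA_mulVec]
  split_ifs
  · exact mul_nonneg (Complex.zero_le_real.2 (J.a_pos _).le) (hy _)
  · exact le_rfl

end Blocks

theorem LegoView.edist_shift_le_one {V' E' V E : Type*} {H : Multigraph V' E'}
    {G : Multigraph V E} {c : Covering H G} {ℓ : ℕ} {cut : Fin ℓ ↪ E} {W : Type*}
    (L : LegoView c cut W) (i : Fin ℓ) (u : W) :
    L.skeleton.toSimple.edist u (L.shift i u) ≤ 1 := by
  rw [SimpleGraph.edist_le_one_iff_adj_or_eq]
  by_cases h : u = L.shift i u
  · exact Or.inr h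
  · exact Or.inl ⟨h, Or.inl ⟨(u, i), rfl, rfl⟩⟩

section Cover

variable {V' E' V E : Type*} [Fintype V'] [DecidableEq V'] [Fintype E'] [Fintype V]
  [DecidableEq V] [Fintype E] {H : Multigraph V' E'} {G : Multigraph V E}
  {c : Covering H G} {ℓ : ℕ} {cut : Fin ℓ ↪ E} {W : Type*} [Fintype W]
  (L : LegoView c cut W)

theorem re_inner_blockVec_lift_self (J : JacobiData G) (y : EuclideanSpace ℂ V) (g : W → ℝ) :
    (inner ℂ (blockVec L y g) (Matrix.toEuclideanLin (J.lift c).matrix (blockVec L y g))).re =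
      (∑ u, g u * g u) * quadForm (blockB J cut) y +
        2 * ∑ i, quadForm (blockA J cut i) y * ∑ u, g u * g (L.shift i u) := by
  rw [inner_blockVec_lift]
  simp only [Complex.add_re, Complex.re_sum, Complex.re_ofReal_mul]
  rw [Finset.mul_sum]
  congr 1
  refine Finset.sum_congr rfl fun i _ => ?_
  have h1 : ∑ u, g u * g ((L.shift i).symm u) = ∑ u, g u * g (L.shift i u) := by
    rw [← Equiv.sum_comp (L.shift i)]
    simp [mul_comm]
  have h2 := quadForm_conjTranspose y (blockA J cut i)
  rw [quadForm, quadForm] at h2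
  rw [h1, h2, quadForm]
  ring

/-- The Rayleigh quotient of a single test vector, built from `n + 1` levels around an edge weighted
by `A_j`. -/
theorem rayleigh_testFun_ge (J : JacobiData G) {y : EuclideanSpace ℂ V} (hy1 : ‖y‖ = 1)
    (hy : ∀ v, 0 ≤ y v) (j : Fin ℓ) (p : W) (n : ℕ) {m : ℝ}
    (hm : m = (∑ i, quadForm (blockA J cut i) y) / ℓ) :
    (quadForm (blockB J cut) y + 2 * √(2 * ℓ - 1) * m -
        ((2 * √(2 * ℓ - 1) - 1) * m + |m - quadForm (blockA J cut j) y|) / ((n + 1 : ℕ) : ℝ)) *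
      ‖blockVec L y (testFun L.shift j p n)‖ ^ 2 ≤
    (inner ℂ (blockVec L y (testFun L.shift j p n)) (Matrix.toEuclideanLin (J.lift c).matrix
      (blockVec L y (testFun L.shift j p n)))).re := by
  have hq := degree_sub_one_ge_one j
  have hE := le_sum_testFun_mul_testFun L.shift j p
    (fun i => quadForm_blockA_nonneg J cut y hy i) n (m := m) (by simpa using hm)
  obtain ⟨hS1, hS2⟩ := sum_neg_inv_pow_mem_Icc hq n
  rw [Fintype.card_fin] at hq hE hS1 hS2
  rw [re_inner_blockVec_lift_self, sum_testFun_sq]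
  have hn : ‖blockVec L y (testFun L.shift j p n)‖ ^ 2 = 2 * (n + 1) := by
    have h := inner_blockVec L y (testFun L.shift j p n) (testFun L.shift j p n)
    rw [sum_testFun_sq, inner_self_eq_norm_sq_to_K, inner_self_eq_norm_sq_to_K, hy1] at h
    have h' : ((‖blockVec L y (testFun L.shift j p n)‖ ^ 2 : ℝ) : ℂ) =
        ((2 * (n + 1) : ℝ) : ℂ) := by
      simpa using h
    exact_mod_cast h'
  rw [hn]
  set q : ℝ := 2 * ℓ - 1
  set S := ∑ k ∈ Finset.range n, (-q⁻¹) ^ (k + 1)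
  set α := quadForm (blockA J cut j) y
  have hs : √q * q⁻¹ ≤ 1 := by
    rw [← div_eq_mul_inv, Real.sqrt_div_self]
    exact inv_le_one_of_one_le₀ (Real.one_le_sqrt.2 hq)
  have hs0 := Real.sqrt_nonneg q
  -- the deviation of the weight of the root edge enters with a factor in `[-1, 1]`
  have habs : (m - α) * (1 + 2 * √q * S) ≤ |m - α| := by
    refine (le_abs_self _).trans ?_
    rw [abs_mul]
    refine mul_le_of_le_one_right (abs_nonneg _) (abs_le.2 ⟨?_, ?_⟩) <;> nlinarith
  have hn0 : (0 : ℝ) < n + 1 := by positivity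
  push_cast
  have hC : (quadForm (blockB J cut) y + 2 * √q * m -
      ((2 * √q - 1) * m + |m - α|) / (n + 1)) * (2 * (n + 1)) =
      2 * (n + 1) * (quadForm (blockB J cut) y + 2 * √q * m) -
        2 * ((2 * √q - 1) * m + |m - α|) := by
    field_simp
  rw [hC]
  linarith

end Cover

theorem mainTheorem1 {V E V' E' W : Type*}
    [Fintype V] [DecidableEq V] [Fintype E]
    [Fintype V'] [DecidableEq V'] [Fintype E']
    (G₀ : Multigraph V E) (J₀ : JacobiData G₀)
    (ℓ : ℕ) (cut : Fin ℓ ↪ E) (hcut : IsTreeCut G₀ cut)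
    (H : Multigraph V' E') (c : Covering H G₀) (L : LegoView c cut W)
    (r : ℕ) (hr : 1 ≤ r) (j : Fin ℓ) (e₁ e₂ : W × Fin ℓ) (he₁ : e₁.2 = j) (he₂ : e₂.2 = j)
    (hdist : ∀ p ∈ ({L.skeleton.src e₁, L.skeleton.tgt e₁} : Set W),
      ∀ q ∈ ({L.skeleton.src e₂, L.skeleton.tgt e₂} : Set W),
        ((2 * r + 2 : ℕ) : ℕ∞) < L.skeleton.edist p q) :
    ∃ hcard : 1 < Fintype.card V',
      ∀ y : EuclideanSpace ℂ V, ‖y‖ = 1 → (∀ v, 0 ≤ y v) →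
        let d : ℝ := 2 * ℓ
        let Ay : ℝ := quadForm (blockSum J₀ cut) y
        let C : ℝ := (2 * √(d - 1) - 1) * (Ay / d) +
          |Ay / d - quadForm (blockA J₀ cut j) y|
        quadForm (blockB J₀ cut) y + 2 * √(d - 1) * (Ay / d) - C / r ≤
          lambdaTwo (J₀.lift c).isHermitian hcard := by
  obtain ⟨v₀⟩ := hcut.tree.connected.nonempty
  have : Finite W := Finite.of_surjective (fun z => (L.pos z).1) fun u =>
    ⟨L.pos.symm (u, v₀), by simp⟩
  have := Fintype.ofFinite W
  obtain ⟨p₁, i₁⟩ := e₁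
  obtain ⟨p₂, i₂⟩ := e₂
  obtain rfl : i₁ = j := he₁
  obtain rfl : i₂ = i₁ := he₂
  obtain ⟨n, rfl⟩ : ∃ n, r = n + 1 := ⟨r - 1, by omega⟩
  have hcard : 1 < Fintype.card V' := by
    refine Fintype.one_lt_card_iff.2 ⟨L.pos.symm (p₁, v₀), L.pos.symm (p₂, v₀), fun h => ?_⟩
    have hp : p₁ = p₂ := congrArg Prod.fst (L.pos.symm.injective h)
    have h1 := hdist p₁ (Or.inl rfl) p₂ (Or.inl rfl)
    rw [hp, Multigraph.edist, SimpleGraph.edist_self] at h1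
    exact not_lt_zero h1
  refine ⟨hcard, fun y hy1 hy => ?_⟩
  intro d Ay C
  -- the supports of the two test functions are neither overlapping nor joined by an edge
  have hsupp : ∀ u w, L.skeleton.toSimple.edist u w ≤ 1 →
      testFun L.shift i₂ p₁ n u * testFun L.shift i₂ p₂ n w = 0 := by
    intro u w huw
    by_contra h
    obtain ⟨a, ha, hau⟩ := exists_edist_le_of_testFun_ne_zero L.shift i₂ p₁ L.edist_shift_le_one
      (left_ne_zero_of_mul h)
    obtain ⟨b, hb, hbw⟩ := exists_edist_le_of_testFun_ne_zero L.shift i₂ p₂ L.edist_shift_le_one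
      (right_ne_zero_of_mul h)
    rw [SimpleGraph.edist_comm] at hbw
    have h1 : L.skeleton.toSimple.edist a b ≤ ((n + (1 + n) : ℕ) : ℕ∞) := by
      push_cast
      exact (SimpleGraph.edist_triangle (v := u)).trans (add_le_add hau
        ((SimpleGraph.edist_triangle (v := w)).trans (add_le_add huw hbw)))
    have h2 := (hdist a ha b hb).trans_le h1
    rw [Nat.cast_lt] at h2
    omega
  have hsymm : ∀ i u, L.skeleton.toSimple.edist u ((L.shift i).symm u) ≤ 1 := fun i u => by
    simpa [SimpleGraph.edist_comm] using L.edist_shift_le_one i ((L.shift i).symm u)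
  have hm : Ay / d = (∑ i, quadForm (blockA J₀ cut i) y) / ℓ := by
    simp only [Ay, d, quadForm_blockSum]
    rw [mul_div_mul_left _ _ two_ne_zero]
  have hne : ∀ p, blockVec L y (testFun L.shift i₂ p n) ≠ 0 := by
    intro p h0
    have h := inner_blockVec L y (testFun L.shift i₂ p n) (testFun L.shift i₂ p n)
    rw [sum_testFun_sq, h0, inner_zero_left, inner_self_eq_norm_sq_to_K, hy1] at h
    have h' : (0 : ℂ) = ((2 * (n + 1) : ℝ) : ℂ) := by simpa using h
    have h'' : (0 : ℝ) = 2 * (n + 1) := by exact_mod_cast h'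
    linarith [(n.cast_nonneg : (0 : ℝ) ≤ n)]
  refine le_lambdaTwo _ hcard (hne p₁) (hne p₂) ?_ ?_
    (rayleigh_testFun_ge L J₀ hy1 hy i₂ p₁ n hm) (rayleigh_testFun_ge L J₀ hy1 hy i₂ p₂ n hm)
  · rw [inner_blockVec, Finset.sum_eq_zero fun u _ => hsupp u u (by simp)]
    simp
  · rw [inner_blockVec_lift, Finset.sum_eq_zero fun u _ => hsupp u u (by simp)]
    simp [hsupp _ _ (L.edist_shift_le_one _ _), hsupp _ _ (hsymm _ _)]
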